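/- **Conventions.** For \(\pi=\pi_1\cdots\pi_n\in S_n\), an inversion is a pair \(i<j\) with \(\pi_i>\pi_j\), and \(\mathrm{inv}(\pi)\) is the number of inversions. A permutation avoids a set \(B\) of patterns if it has no subsequence order-isomorphic to an element of \(B\); it is indecomposable if it is nonempty and is not a direct sum of two nonempty permutations. Let \(I_k(B)\) be the set of indecomposable \(B\)-avoiding permutations (of any length) with exactly \(k\) inversions, and let \(\mathrm{av}_n^k(B)\) be the number of \(B\)-avoiding permutations in \(S_n\) with exactly \(k\) inversions. If for every \(k\) the value \(\mathrm{av}_n^k(B)\) equals a constant \(c_k(B)\) for all sufficiently large \(n\), we say that \(B\) has a limit sequence, and its limit generating function is \(C_B(x)=\sum_{k\ge 0}c_k(B)x^k\). For a \(132\)-avoiding permutation \(\pi\), let \(\Lambda(\pi)\) be the integer partition obtained by deleting the trailing zeros of the inversion table \((b_1,\dots,b_n)\), where \(b_i=|\{j>i:\pi_i>\pi_j\}|\) (for \(132\)-avoiders this table is weakly decreasing). The sand pile model \(\mathrm{SPM}(k)\) is the smallest set of partitions of \(k\) that contains \((k)\) (the empty partition if \(k=0\)) and contains, with each \(\lambda\),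 every partition obtained from \(\lambda\) by subtracting one from a part and adding one to the next part (the part following the last one being \(0\)). **Proposition.** For every \(k\ge 0\), the map \(\Lambda\) restricts to a bijection from \(I_k(132,2341)\) onto \(\mathrm{SPM}(k)\). Moreover, the sets \(\{132,2341\}\) and \(\{1324,2341\}\) have limit sequences, and, as formal power series, \[ C_{132,2341}(x)=1+\sum_{k\ge 1}x^{k(k+1)/2}\prod_{i=1}^{k}\left(x+\frac{1}{1-x^i}\right), \qquad C_{1324,2341}(x)=\left(1+\sum_{k\ge 1}x^{k(k+1)/2}\prod_{i=1}^{k}\left(x+\frac{1}{1-x^i}\right)\right)^{2}. \] -/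

import Mathlib

open scoped PowerSeries.WithPiTopology

namespace PermPattern

/-- Permutations of arbitrary length: `⟨n, π⟩` is `π ∈ S_n`, with positions and values
numbered `0, …, n - 1` instead of `1, …, n`. -/
abbrev AnyPerm : Type := Σ n : ℕ, Equiv.Perm (Fin n)

/-- `π` contains `p`: some subsequence of `π` is order-isomorphic to `p`. -/
def Contains {n m : ℕ} (π : Equiv.Perm (Fin n)) (p : Equiv.Perm (Fin m)) : Prop :=
  ∃ f : Fin m ↪o Fin n, ∀ i j : Fin m, π (f i) < π (f j) ↔ p i < p j

/-- `π` avoids every pattern in the set `B`. -/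
def Avoids {n : ℕ} (π : Equiv.Perm (Fin n)) (B : Set AnyPerm) : Prop :=
  ∀ p ∈ B, ¬ Contains π p.2

/-- The number of inversions: pairs of positions `i < j` with `π i > π j`. -/
def inv {n : ℕ} (π : Equiv.Perm (Fin n)) : ℕ :=
  (Finset.univ.filter fun q : Fin n × Fin n => q.1 < q.2 ∧ π q.2 < π q.1).card

/-- The direct sum `σ ⊕ τ`: `σ` on the first `|σ|` positions and values,
`τ` shifted by `|σ|` on the remaining ones. -/
def directSum (σ τ : AnyPerm) : AnyPerm :=
  ⟨σ.1 + τ.1, finSumFinEquiv.permCongr (Equiv.sumCongr σ.2 τ.2)⟩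

/-- `π` has exactly one component: it is nonempty and is not the direct sum of two
nonempty permutations. -/
def Indecomposable (π : AnyPerm) : Prop :=
  π.1 ≠ 0 ∧ ∀ σ τ : AnyPerm, π = directSum σ τ → σ.1 = 0 ∨ τ.1 = 0

/-- `I_k(B)`: the indecomposable `B`-avoiders (of any length) with exactly `k` inversions. -/
def indecomposableAvoiders (B : Set AnyPerm) (k : ℕ) : Set AnyPerm :=
  {π | Indecomposable π ∧ Avoids π.2 B ∧ inv π.2 = k}

/-- `av_n^k(B)`: the number of `B`-avoiders of length `n` with exactly `k` inversions. -/
noncomputable def av (B : Set AnyPerm) (n k : ℕ) : ℕ :=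
  {π : Equiv.Perm (Fin n) | Avoids π B ∧ inv π = k}.ncard

/-- `c` is the limit sequence of `B`: for every `k`, `av_n^k(B) = c k` for all large `n`. -/
def IsLimitSequence (B : Set AnyPerm) (c : ℕ → ℕ) : Prop :=
  ∀ k, ∃ m, ∀ n, m ≤ n → av B n k = c k

/-- `B` has a limit sequence `c`, and `F = ∑ c_k x^k` is its limit generating function `C_B`. -/
def IsLimitGenFun (B : Set AnyPerm) (F : PowerSeries ℚ) : Prop :=
  ∃ c : ℕ → ℕ, IsLimitSequence B c ∧ F = PowerSeries.mk fun k => (c k : ℚ)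

/-- The entry of the inversion table (Lehmer code) of `π` at position `i`: the number of later
positions with a smaller value. -/
def lehmer {n : ℕ} (π : Equiv.Perm (Fin n)) (i : Fin n) : ℕ :=
  (Finset.univ.filter fun j : Fin n => i < j ∧ π j < π i).card

/-- The sequence `λ` (indexed from `0`, and continued by zeros after its last part) is a
partition of `k`: it is weakly decreasing and its entries sum to `k`. -/
def IsPartitionOf (l : ℕ →₀ ℕ) (k : ℕ) : Prop :=
  Antitone l ∧ (l.sum fun _ a => a) = k

/-- `Λ(π)`: the inversion table of `π`, with trailing zeros disregarded (as partitions are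
represented by sequences continued by zeros). -/
noncomputable def Lam (π : AnyPerm) : ℕ →₀ ℕ :=
  Finsupp.onFinset (Finset.range π.1)
    (fun i => if h : i < π.1 then lehmer π.2 ⟨i, h⟩ else 0)
    (fun i hi => by
      by_contra hn
      rw [Finset.mem_range] at hn
      simp [hn] at hi)

/-- `μ` arises from `l` by subtracting one from a (positive) part and adding one to the next
part, where the part after the last one is `0`. -/
def SandMove (l μ : ℕ →₀ ℕ) : Prop :=
  ∃ i : ℕ, l i = μ i + 1 ∧ μ (i + 1) = l (i + 1) + 1 ∧
    ∀ j, j ≠ i → j ≠ i + 1 → μ j = l j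

/-- Membership in the sand pile model `SPM(k)`: it contains `(k)`, and every partition that
arises by a move from one of its elements. -/
inductive InSPM (k : ℕ) : (ℕ →₀ ℕ) → Prop
  | start : InSPM k (Finsupp.single 0 k)
  | move {l μ : ℕ →₀ ℕ} : InSPM k l → SandMove l μ → IsPartitionOf μ k → InSPM k μ

/-- The sand pile model `SPM(k)`. -/
def SPM (k : ℕ) : Set (ℕ →₀ ℕ) := {l | InSPM k l}

/-- The pattern `132`. -/
def p132 : AnyPerm := ⟨3, ⟨![0, 2, 1], ![0, 2, 1], by decide, by decide⟩⟩

/-- The pattern `1324`. -/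
def p1324 : AnyPerm := ⟨4, ⟨![0, 2, 1, 3], ![0, 2, 1, 3], by decide, by decide⟩⟩

/-- The pattern `2341`. -/
def p2341 : AnyPerm := ⟨4, ⟨![1, 2, 3, 0], ![3, 0, 1, 2], by decide, by decide⟩⟩

/-- The formal power series `x^{k(k+1)/2} ∏_{i=1}^k (x + 1/(1 - x^i))`. -/
noncomputable def spmTerm (k : ℕ) : PowerSeries ℚ :=
  PowerSeries.X ^ (k * (k + 1) / 2) *
    ∏ i ∈ Finset.Icc 1 k, (PowerSeries.X + (1 - PowerSeries.X ^ i)⁻¹)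

/-- The formal power series `1 + ∑_{k ≥ 1} x^{k(k+1)/2} ∏_{i=1}^k (x + 1/(1 - x^i))`
(the sum converges coefficientwise). -/
noncomputable def spmSeries : PowerSeries ℚ := 1 + ∑' k : ℕ, spmTerm (k + 1)

end PermPattern

/-!
A permutation is determined by its Lehmer code, and it avoids `132` exactly when the code `l` is
weakly decreasing. For such permutations, avoiding `2341` means that `l r + r ≤ l p + p + 1`
whenever `p < r` and `l r > 0`: this says that at most one entry strictly after position `p`, up to
position `r`, exceeds the entry at `p`. The partitions with this property form the sand pile
model, since the property is preserved by moves, and conversely every such partition with at least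
two parts arises by a move from another one. A `132`-avoider is indecomposable exactly when it is
the shortest permutation with its code, while a length `n > k` admits every code of size `k`.

For the generating function, classify the sand piles by the largest `k` for which the staircase
`(k, …, 1)` fits into them. If such a pile of rank `k + 1` has `k + 2` parts, removing a full
column leaves an arbitrary pile of rank `k`; if it has `k + 1` parts, removing a full column leaves
either a pile of rank `k` or another pile of rank `k + 1` with `k + 1` parts. The resulting
recurrence contributes one factor of the product at each rank.

Finally, in a `1324`-avoider every inversion either has no smaller entry to its left or no
larger entry to its right, and then there are many inversions unless both of its ends are near
the same end of the permutation. So a long `{1324, 2341}`-avoider with few inversions is a direct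
sum of a `{132, 2341}`-avoider and a `{213, 2341}`-avoider; the two factors are counted alike by
the symmetry of inverting the reverse complement, which yields the square.
-/

namespace PermPattern

open Finset

variable {m n : ℕ} {π : Equiv.Perm (Fin n)}

/-! ### Patterns and Lehmer codes -/

/-- The pattern `213`, the reverse complement of `132`. -/
def p213 : AnyPerm := ⟨3, ⟨![1, 0, 2], ![1, 0, 2], by decide, by decide⟩⟩

theorem contains_iff_exists_strictMono {p : Equiv.Perm (Fin m)} :
    Contains π p ↔ ∃ f : Fin m → Fin n, StrictMono f ∧ StrictMono (π ∘ f ∘ p.symm) := by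
  constructor
  · rintro ⟨f, hf⟩
    exact ⟨f, f.strictMono, fun u v huv => (hf _ _).2 (by simpa using huv)⟩
  · rintro ⟨f, hf, hπ⟩
    refine ⟨OrderEmbedding.ofStrictMono f hf, fun i j => ?_⟩
    simpa using hπ.lt_iff_lt (a := p i) (b := p j)

theorem contains_p132_iff :
    Contains π p132.2 ↔ ∃ a b c, a < b ∧ b < c ∧ π a < π c ∧ π c < π b := by
  rw [contains_iff_exists_strictMono, p132, ← FinVec.exists_iff]
  simp [FinVec.Exists, Fin.strictMono_iff_lt_succ, Fin.forall_fin_succ, and_assoc]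

theorem contains_p213_iff :
    Contains π p213.2 ↔ ∃ a b c, a < b ∧ b < c ∧ π b < π a ∧ π a < π c := by
  rw [contains_iff_exists_strictMono, p213, ← FinVec.exists_iff]
  simp [FinVec.Exists, Fin.strictMono_iff_lt_succ, Fin.forall_fin_succ, and_assoc]

theorem contains_p1324_iff :
    Contains π p1324.2 ↔
      ∃ a b c d, a < b ∧ b < c ∧ c < d ∧ π a < π c ∧ π c < π b ∧ π b < π d := by
  rw [contains_iff_exists_strictMono, p1324, ← FinVec.exists_iff]
  simp [FinVec.Exists, Fin.strictMono_iff_lt_succ, Fin.forall_fin_succ, and_assoc]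

theorem contains_p2341_iff :
    Contains π p2341.2 ↔
      ∃ a b c d, a < b ∧ b < c ∧ c < d ∧ π d < π a ∧ π a < π b ∧ π b < π c := by
  rw [contains_iff_exists_strictMono, p2341, ← FinVec.exists_iff]
  simp [FinVec.Exists, Fin.strictMono_iff_lt_succ, Fin.forall_fin_succ, and_assoc]

theorem not_contains_p132_iff :
    ¬ Contains π p132.2 ↔ ∀ a b c, a < b → b < c → π c < π b → π c < π a := by
  rw [contains_p132_iff]
  refine ⟨fun h a b c hab hbc hcb => ?_, fun h ⟨a, b, c, hab, hbc, hac, hcb⟩ =>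
    hac.not_gt (h a b c hab hbc hcb)⟩
  by_contra hac
  refine h ⟨a, b, c, hab, hbc, (not_lt.1 hac).lt_of_ne ?_, hcb⟩
  exact fun e => (hab.trans hbc).ne (π.injective e)

theorem avoids_pair_iff {p q : AnyPerm} :
    Avoids π {p, q} ↔ ¬ Contains π p.2 ∧ ¬ Contains π q.2 := by
  simp [Avoids]

theorem inv_eq_sum_lehmer (π : Equiv.Perm (Fin n)) : inv π = ∑ i, lehmer π i := by
  simp only [inv, lehmer, card_filter, Fintype.sum_prod_type]

theorem lehmer_add_lt (π : Equiv.Perm (Fin n)) (i : Fin n) : lehmer π i + i < n := by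
  have h : lehmer π i ≤ #(Ioi i) := card_le_card fun j hj => by simp_all
  rw [Fin.card_Ioi] at h
  omega

theorem lehmer_pos_iff {i : Fin n} : 0 < lehmer π i ↔ ∃ j, i < j ∧ π j < π i := by
  simp [lehmer, card_pos, Finset.Nonempty]

theorem lehmer_eq_card_values (π : Equiv.Perm (Fin n)) (i : Fin n) :
    lehmer π i = #(Iio (π i) \ (Iio i).image π) := by
  rw [lehmer, ← card_map π.toEmbedding]
  congr 1
  ext v
  obtain ⟨j, rfl⟩ := π.surjective v
  simpa [and_comm] using fun h : π j < π i => ⟨le_of_lt, (lt_of_le_of_ne · (by grind))⟩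

theorem lehmer_lt_of_apply_lt {ρ : Equiv.Perm (Fin n)} {i : Fin n} (h : ∀ j < i, π j = ρ j)
    (hi : π i < ρ i) : lehmer π i < lehmer ρ i := by
  have himage : (Iio i).image π = (Iio i).image ρ := image_congr fun j hj => h j (by simpa using hj)
  have hnotMem : π i ∉ (Iio i).image π := by simp
  rw [lehmer_eq_card_values, lehmer_eq_card_values, ← himage]
  refine card_lt_card (ssubset_iff_of_subset ?_ |>.2 ⟨π i, ?_, ?_⟩)
  · exact sdiff_subset_sdiff (Iio_subset_Iio hi.le) subset_rfl
  · exact mem_sdiff.2 ⟨mem_Iio.2 hi, hnotMem⟩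
  · simp

theorem lehmer_injective : Function.Injective (lehmer : Equiv.Perm (Fin n) → Fin n → ℕ) := by
  intro π ρ h
  ext1 i
  induction i using WellFoundedLT.induction with
  | ind i ih =>
    rcases lt_trichotomy (π i) (ρ i) with hi | hi | hi
    · exact absurd (congrFun h i) (lehmer_lt_of_apply_lt ih hi).ne
    · exact hi
    · exact absurd (congrFun h i) (lehmer_lt_of_apply_lt (fun j hj => (ih j hj).symm) hi).ne'

theorem exists_lehmer_eq {b : Fin n → ℕ} (hb : ∀ i, b i + i < n) :
    ∃ π : Equiv.Perm (Fin n), lehmer π = b := by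
  let code (π : Equiv.Perm (Fin n)) (i : Fin n) : Fin (n - i) :=
    ⟨lehmer π i, by have := lehmer_add_lt π i; omega⟩
  have hinj : Function.Injective code := fun π ρ h =>
    lehmer_injective (funext fun i => congrArg Fin.val (congrFun h i))
  have hcard : Fintype.card (Equiv.Perm (Fin n)) = Fintype.card (∀ i : Fin n, Fin (n - i)) := by
    simp only [Fintype.card_perm, Fintype.card_pi, Fintype.card_fin]
    rw [Fin.prod_univ_eq_prod_range (fun i => n - i) n, ← Nat.descFactorial_eq_prod_range,
      Nat.descFactorial_self]
  obtain ⟨π, hπ⟩ := ((Fintype.bijective_iff_injective_and_card code).2 ⟨hinj, hcard⟩).2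
    fun i => ⟨b i, by have := hb i; omega⟩
  exact ⟨π, funext fun i => congrArg Fin.val (congrFun hπ i)⟩

theorem antitone_lehmer_iff : Antitone (lehmer π) ↔ ¬ Contains π p132.2 := by
  constructor
  · rw [contains_p132_iff]
    rintro h ⟨a, j, k, haj, hjk, hak, hkj⟩
    obtain ⟨i, hi, hmax⟩ := exists_max_image {i | i < j ∧ π i < π k} id
      ⟨a, mem_filter.2 ⟨mem_univ a, haj, hak⟩⟩
    simp only [mem_filter, mem_univ, true_and, id, and_imp] at hi hmax
    refine (h hi.1.le).not_gt (card_lt_card ((ssubset_iff_of_subset fun x hx => ?_).2 ⟨k, ?_, ?_⟩))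
    · simp only [mem_filter, mem_univ, true_and] at hx ⊢
      have hxk : π x < π k := hx.2.trans hi.2
      refine ⟨lt_of_not_ge fun hxj => ?_, hxk.trans hkj⟩
      rcases hxj.eq_or_lt with rfl | hxj
      · exact hxk.not_gt hkj
      · exact (hmax x hxj hxk).not_gt hx.1
    · simp [hjk, hkj]
    · simp [hi.2.le]
  · rw [not_contains_p132_iff]
    intro h i j hij
    rcases hij.eq_or_lt with rfl | hij
    · exact le_rfl
    · refine card_le_card fun x hx => ?_
      simp only [mem_filter, mem_univ, true_and] at hx ⊢
      exact ⟨hij.trans hx.1, h i j x hij hx.1 hx.2⟩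

theorem lehmer_eq_card_Ioi (π : Equiv.Perm (Fin n)) (i : Fin n) :
    lehmer π i = #{j ∈ Ioi i | π j < π i} := by
  rw [lehmer, ← filter_filter, filter_lt_eq_Ioi]

theorem card_window_add_lehmer {p r : Fin n} (hpr : p ≤ r) :
    #{x ∈ Ioc p r | π p < π x} + lehmer π p + p = #{x ∈ Ioi r | π x < π p} + r := by
  have hwindow : #{x ∈ Ioc p r | π p < π x} + #{x ∈ Ioc p r | π x < π p} = r - p := by
    rw [← Fin.card_Ioc, ← card_filter_add_card_filter_not (s := Ioc p r) (π p < π ·)]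
    congr 2
    refine filter_congr fun x hx => ?_
    simpa using ((π.injective.ne (mem_Ioc.1 hx).1.ne').le_iff_lt).symm
  have hlehmer : lehmer π p = #{x ∈ Ioc p r | π x < π p} + #{x ∈ Ioi r | π x < π p} := by
    have hunion : Ioc p r ∪ Ioi r = Ioi p := coe_injective (by simp [Set.Ioc_union_Ioi_eq_Ioi hpr])
    rw [lehmer_eq_card_Ioi, ← hunion, filter_union, card_union_of_disjoint]
    refine disjoint_filter_filter (disjoint_left.2 fun x hx hxr => ?_)
    exact (mem_Ioc.1 hx).2.not_gt (mem_Ioi.1 hxr)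
  have : (p : ℕ) ≤ r := hpr
  omega

theorem card_window_le_one (h132 : ¬ Contains π p132.2) (h2341 : ¬ Contains π p2341.2)
    {p r : Fin n} (hpr : p < r) (hr : 0 < lehmer π r) : #{x ∈ Ioc p r | π p < π x} ≤ 1 := by
  rw [not_contains_p132_iff] at h132
  obtain ⟨y, hry, hyr⟩ := lehmer_pos_iff.1 hr
  refine card_le_one.2 fun a ha b hb => ?_
  wlog hab : a ≤ b generalizing a b
  · exact (this b hb a ha (le_of_not_ge hab)).symm
  simp only [mem_filter, mem_Ioc] at ha hb
  by_contra hne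
  have hab : a < b := hab.lt_of_ne hne
  have hπ : π a < π b := lt_of_not_ge fun h =>
    (h132 p a b ha.1.1 hab (h.lt_of_ne' (π.injective.ne hne))).not_gt hb.2
  exact h2341 (contains_p2341_iff.2
    ⟨p, a, b, y, ha.1.1, hab, hb.1.2.trans_lt hry, h132 p r y hpr hry hyr, ha.2, hπ⟩)

theorem not_contains_p2341_iff (h132 : ¬ Contains π p132.2) :
    ¬ Contains π p2341.2 ↔
      ∀ p r, p < r → 0 < lehmer π r → lehmer π r + r ≤ lehmer π p + p + 1 := by
  constructor
  · intro h2341 p r hpr hr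
    have hle : lehmer π r ≤ #{x ∈ Ioi r | π x < π p} := by
      rw [lehmer_eq_card_Ioi]
      refine card_le_card fun x hx => ?_
      simp only [mem_filter, mem_Ioi] at hx ⊢
      exact ⟨hx.1, not_contains_p132_iff.1 h132 p r x hpr hx.1 hx.2⟩
    have := card_window_le_one h132 h2341 hpr hr
    have := card_window_add_lehmer (π := π) hpr.le
    omega
  · rw [contains_p2341_iff]
    rintro h ⟨a, b, c, d, hab, hbc, hcd, hda, hπab, hπbc⟩
    have hac : π a < π c := hπab.trans hπbc
    have hle : #{x ∈ Ioi c | π x < π a} ≤ lehmer π c := by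
      rw [lehmer_eq_card_Ioi]
      exact card_le_card (monotone_filter_right _ fun x _ hx => hx.trans hac)
    have hwindow : 1 < #{x ∈ Ioc a c | π a < π x} :=
      one_lt_card.2 ⟨b, by simp [hab, hbc.le, hπab], c, by simp [hab.trans hbc, hac], hbc.ne⟩
    have := h a c (hab.trans hbc) (lehmer_pos_iff.2 ⟨d, hcd, hda.trans hac⟩)
    have := card_window_add_lehmer (π := π) (hab.trans hbc).le
    omega

theorem Lam_apply (π : Equiv.Perm (Fin n)) (i : Fin n) : Lam ⟨n, π⟩ i = lehmer π i := by
  simp [Lam]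

theorem Lam_apply_of_le {i : ℕ} (h : n ≤ i) : Lam ⟨n, π⟩ i = 0 := by
  simp [Lam, h]

theorem lt_of_Lam_pos {i : ℕ} (h : 0 < Lam ⟨n, π⟩ i) : i < n :=
  lt_of_not_ge fun hi => h.ne' (Lam_apply_of_le hi)

theorem Lam_add_lt {i : ℕ} (h : 0 < Lam ⟨n, π⟩ i) : Lam ⟨n, π⟩ i + i < n := by
  lift i to Fin n using lt_of_Lam_pos h
  exact Lam_apply π i ▸ lehmer_add_lt π i

theorem degree_Lam (π : Equiv.Perm (Fin n)) : (Lam ⟨n, π⟩).degree = inv π := by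
  have hsupport : (Lam ⟨n, π⟩).support ⊆ range n := Finsupp.support_onFinset_subset
  rw [inv_eq_sum_lehmer, Finsupp.degree_apply, sum_subset hsupport (by simp), sum_range]
  exact sum_congr rfl fun i _ => Lam_apply π i

theorem Lam_mk_injective : Function.Injective fun π : Equiv.Perm (Fin n) => Lam ⟨n, π⟩ := by
  refine fun π ρ h => lehmer_injective (funext fun i => ?_)
  rw [← Lam_apply, ← Lam_apply]
  exact DFunLike.congr_fun h (i : ℕ)

theorem exists_Lam_eq {l : ℕ →₀ ℕ} (h : ∀ i, 0 < l i → l i + i < n) :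
    ∃ π : Equiv.Perm (Fin n), Lam ⟨n, π⟩ = l := by
  obtain ⟨π, hπ⟩ := exists_lehmer_eq (n := n) (b := fun i => l i) fun i => by
    have := h i
    omega
  refine ⟨π, Finsupp.ext fun i => ?_⟩
  rcases lt_or_ge i n with hi | hi
  · lift i to Fin n using hi
    rw [Lam_apply, hπ]
  · rw [Lam_apply_of_le hi]
    have := h i
    omega

theorem antitone_Lam_iff : Antitone (Lam ⟨n, π⟩) ↔ ¬ Contains π p132.2 := by
  rw [← antitone_lehmer_iff]
  refine ⟨fun h i j hij => ?_, fun h i j hij => ?_⟩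
  · rw [← Lam_apply, ← Lam_apply]
    exact h hij
  · rcases lt_or_ge j n with hj | hj
    · lift i to Fin n using hij.trans_lt hj
      lift j to Fin n using hj
      rw [Lam_apply, Lam_apply]
      exact h hij
    · simp [Lam_apply_of_le hj]

/-- An intrinsic description of the sand pile model: `l` is weakly decreasing, and along its
positive entries `l i + i` never exceeds an earlier value by more than one. -/
def IsSandPile (l : ℕ →₀ ℕ) : Prop :=
  Antitone l ∧ ∀ p r, p < r → 0 < l r → l r + r ≤ l p + p + 1

theorem avoids_iff_isSandPile : Avoids π {p132, p2341} ↔ IsSandPile (Lam ⟨n, π⟩) := by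
  rw [avoids_pair_iff, IsSandPile, antitone_Lam_iff]
  refine and_congr_right fun h132 => (not_contains_p2341_iff h132).trans ?_
  refine ⟨fun h p r hpr hr => ?_, fun h p r hpr => ?_⟩
  · have hrn := lt_of_Lam_pos hr
    lift p to Fin n using hpr.trans hrn
    lift r to Fin n using hrn
    rw [Lam_apply] at hr ⊢
    rw [Lam_apply]
    exact h p r hpr hr
  · rw [← Lam_apply, ← Lam_apply]
    exact h p r hpr

/-! ### The sand pile model -/

section SandPile

open Finsupp (single)

variable {k : ℕ} {l μ : ℕ →₀ ℕ}

theorem add_single_eq_add_single_iff {i : ℕ} : l + single (i + 1) 1 = μ + single i 1 ↔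
    l i = μ i + 1 ∧ μ (i + 1) = l (i + 1) + 1 ∧ ∀ j, j ≠ i → j ≠ i + 1 → μ j = l j := by
  constructor
  · intro h
    have h (j : ℕ) := DFunLike.congr_fun h j
    simp only [Finsupp.add_apply, Finsupp.single_apply] at h
    grind
  · rintro ⟨hi, hi1, hj⟩
    ext j
    simp only [Finsupp.add_apply, Finsupp.single_apply]
    grind

theorem sandMove_iff : SandMove l μ ↔ ∃ i, l + single (i + 1) 1 = μ + single i 1 :=
  exists_congr fun _ => add_single_eq_add_single_iff.symm

theorem SandMove.degree_eq (h : SandMove l μ) : l.degree = μ.degree := by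
  obtain ⟨i, hi⟩ := sandMove_iff.1 h
  simpa using congrArg Finsupp.degree hi

theorem SandMove.weight_lt (h : SandMove l μ) :
    Finsupp.weight (id : ℕ → ℕ) l < Finsupp.weight (id : ℕ → ℕ) μ := by
  obtain ⟨i, hi⟩ := sandMove_iff.1 h
  have hweight := congrArg (Finsupp.weight (id : ℕ → ℕ)) hi
  simp only [map_add, Finsupp.weight_single, id_eq, smul_eq_mul, one_mul] at hweight
  omega

theorem isSandPile_single (k : ℕ) : IsSandPile (single 0 k) := by
  refine ⟨fun i j hij => ?_, fun p r hpr hr => ?_⟩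
  · simp only [Finsupp.single_apply]
    grind
  · simp [((Nat.zero_le p).trans_lt hpr).ne] at hr

theorem IsSandPile.of_sandMove (hl : IsSandPile l) (h : SandMove l μ) (hμ : Antitone μ) :
    IsSandPile μ := by
  refine ⟨hμ, fun p r hpr hr => ?_⟩
  obtain ⟨i, hi, hi1, hj⟩ := h
  have hle : μ (i + 1) ≤ μ i := hμ i.le_succ
  rcases eq_or_ne r (i + 1) with rfl | hri
  · rcases eq_or_ne p i with rfl | hpi
    · omega
    · have := hl.2 p i (by omega) (by omega)
      have := hj p hpi hpr.ne
      omega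
  · have hrle : μ r ≤ l r := by grind
    rcases eq_or_ne p i with rfl | hpi
    · have := hl.2 (p + 1) r (by omega) (by omega)
      omega
    · have := hl.2 p r hpr (by omega)
      have hple : l p ≤ μ p := by grind
      omega

theorem isSandPile_of_inSPM (h : InSPM k l) : IsSandPile l := by
  induction h with
  | start => exact isSandPile_single k
  | move _ hmove hμ ih => exact ih.of_sandMove hmove hμ.1

theorem isPartitionOf_of_inSPM (h : InSPM k l) : IsPartitionOf l k := by
  induction h with
  | start => exact ⟨(isSandPile_single k).1, by simp⟩
  | move _ _ hμ _ => exact hμ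

theorem IsSandPile.of_undo {i : ℕ} (hμ : IsSandPile μ)
    (h : l + single (i + 1) 1 = μ + single i 1) (hlow : ∀ p < i, μ i + i ≤ μ p + p)
    (hhigh : ∀ r, i + 1 < r → 0 < μ r → μ r + r ≤ μ (i + 1) + (i + 1)) : IsSandPile l := by
  obtain ⟨hi, hi1, hj⟩ := add_single_eq_add_single_iff.1 h
  refine ⟨antitone_nat_of_succ_le fun j => ?_, fun p r hpr hr => ?_⟩
  · have := hμ.1 j.le_succ
    grind
  · rcases eq_or_ne r i with rfl | hri
    · have := hlow p hpr
      grind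
    · have hrle : l r ≤ μ r := by grind
      rcases eq_or_ne p (i + 1) with rfl | hpi
      · have := hhigh r hpr (by omega)
        omega
      · have := hμ.2 p r hpr (by omega)
        grind

theorem IsSandPile.exists_undo_position (h : IsSandPile μ) (h1 : 0 < μ 1) :
    ∃ i, 0 < μ (i + 1) ∧ (∀ p < i, μ i + i ≤ μ p + p) ∧
      ∀ r, i + 1 < r → 0 < μ r → μ r + r ≤ μ (i + 1) + (i + 1) := by
  by_cases hflat : ∃ i, 0 < μ (i + 1) ∧ μ i = μ (i + 1)
  · obtain ⟨i, hi, he⟩ := hflat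
    refine ⟨i, hi, fun p hpi => ?_, fun r hr hr0 => ?_⟩
    · have := h.2 p (i + 1) (by omega) hi
      omega
    · have := h.2 i r (by omega) hr0
      omega
  · push Not at hflat
    refine ⟨0, h1, by simp, fun r hr => ?_⟩
    induction r, hr using Nat.le_induction with
    | base => have := hflat 1; have := h.1 (Nat.le_succ 1); grind
    | succ r _ ih => have := hflat r; have := h.1 r.le_succ; grind

theorem IsSandPile.exists_sandMove (h : IsSandPile μ) (h1 : 0 < μ 1) :
    ∃ l, IsSandPile l ∧ SandMove l μ := by
  obtain ⟨i, hi, hlow, hhigh⟩ := h.exists_undo_position h1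
  have hundo : μ - single (i + 1) 1 + single i 1 + single (i + 1) 1 = μ + single i 1 := by
    rw [add_right_comm, tsub_add_cancel_of_le (Finsupp.single_le_iff.2 hi)]
  exact ⟨_, h.of_undo hundo hlow hhigh, sandMove_iff.2 ⟨i, hundo⟩⟩

theorem inSPM_of_isSandPile (h : IsSandPile l) : InSPM l.degree l := by
  induction hw : Finsupp.weight (id : ℕ → ℕ) l using Nat.strong_induction_on generalizing l with
  | _ w ih =>
    rcases (l 1).eq_zero_or_pos with h1 | h1
    · have hl : l = single 0 (l 0) := by
        refine Finsupp.ext fun i => ?_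
        rcases i with - | i
        · simp
        · have : l (i + 1) ≤ l 1 := h.1 (by omega)
          rw [Finsupp.single_eq_of_ne i.succ_ne_zero]
          omega
      rw [hl, Finsupp.degree_single]
      exact .start
    · obtain ⟨l', hl', hmove⟩ := h.exists_sandMove h1
      have hmem := ih _ (hw ▸ hmove.weight_lt) hl' rfl
      rw [hmove.degree_eq] at hmem
      exact hmem.move hmove ⟨h.1, rfl⟩

theorem mem_SPM_iff : l ∈ SPM k ↔ IsSandPile l ∧ l.degree = k :=
  ⟨fun h => ⟨isSandPile_of_inSPM h, (isPartitionOf_of_inSPM h).2⟩,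
    fun h => h.2 ▸ inSPM_of_isSandPile h.1⟩

end SandPile

/-! ### Direct sums and indecomposability -/

/-- The direct sum of two permutations whose lengths are part of their types. -/
def sumPerm {a b : ℕ} (α : Equiv.Perm (Fin a)) (β : Equiv.Perm (Fin b)) :
    Equiv.Perm (Fin (a + b)) :=
  finSumFinEquiv.permCongr (Equiv.sumCongr α β)

section SumPerm

variable {a b : ℕ}

@[simp]
theorem castAdd_lt_natAdd (i : Fin a) (j : Fin b) : Fin.castAdd b i < Fin.natAdd a j := by
  rw [Fin.lt_def, Fin.val_castAdd, Fin.val_natAdd]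
  omega

@[simp]
theorem castAdd_lt_castAdd_iff {i j : Fin a} : Fin.castAdd b i < Fin.castAdd b j ↔ i < j :=
  (Fin.strictMono_castAdd b).lt_iff_lt

@[simp]
theorem not_natAdd_lt_castAdd (i : Fin a) (j : Fin b) : ¬ Fin.natAdd a j < Fin.castAdd b i :=
  (castAdd_lt_natAdd i j).not_gt

@[simp]
theorem sumPerm_castAdd (α : Equiv.Perm (Fin a)) (β : Equiv.Perm (Fin b)) (i : Fin a) :
    sumPerm α β (Fin.castAdd b i) = Fin.castAdd b (α i) := by
  simp [sumPerm, Equiv.permCongr_apply]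

@[simp]
theorem sumPerm_natAdd (α : Equiv.Perm (Fin a)) (β : Equiv.Perm (Fin b)) (i : Fin b) :
    sumPerm α β (Fin.natAdd a i) = Fin.natAdd a (β i) := by
  simp [sumPerm, Equiv.permCongr_apply]

theorem exists_eq_sumPerm {π : Equiv.Perm (Fin (a + b))}
    (h : ∀ i : Fin (a + b), (i : ℕ) < a → (π i : ℕ) < a) :
    ∃ (α : Equiv.Perm (Fin a)) (β : Equiv.Perm (Fin b)), π = sumPerm α β := by
  let e : Equiv.Perm (Fin a ⊕ Fin b) := finSumFinEquiv.symm.permCongr π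
  have he : Set.MapsTo e (Set.range Sum.inl) (Set.range Sum.inl) := by
    rintro _ ⟨x, rfl⟩
    refine ⟨⟨_, h (Fin.castAdd b x) x.2⟩, finSumFinEquiv.injective (Fin.ext ?_)⟩
    simp [e, Equiv.permCongr_apply]
  obtain ⟨⟨α, β⟩, hαβ : Equiv.sumCongr α β = e⟩ :=
    Equiv.Perm.mem_sumCongrHom_range_of_perm_mapsTo_inl he
  refine ⟨α, β, Equiv.ext fun x => ?_⟩
  simp [sumPerm, hαβ, e, Equiv.permCongr_apply]

theorem apply_last_of_not_contains_sumPerm {α : Equiv.Perm (Fin (a + 1))}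
    {β : Equiv.Perm (Fin (b + 1))} (h132 : ¬ Contains (sumPerm α β) p132.2) :
    β (Fin.last b) = Fin.last b := by
  by_contra hne
  obtain ⟨i, hi⟩ := β.surjective (Fin.last b)
  have hlt : i < Fin.last b := Fin.lt_last_iff_ne_last.2 fun h => hne (h ▸ hi)
  refine h132 (contains_p132_iff.2
    ⟨Fin.castAdd (b + 1) 0, Fin.natAdd (a + 1) i, Fin.natAdd (a + 1) (Fin.last b), ?_⟩)
  simp only [sumPerm_castAdd, sumPerm_natAdd, castAdd_lt_natAdd, true_and,
    Fin.natAdd_lt_natAdd_iff, hi]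
  exact ⟨hlt, Fin.lt_last_iff_ne_last.2 hne⟩

end SumPerm

theorem lehmer_add_eq_iff {i : Fin n} : lehmer π i + i + 1 = n ↔ ∀ j, i < j → π j < π i := by
  have hcard : lehmer π i + i + 1 = n ↔ #(Ioi i) ≤ lehmer π i := by
    have := lehmer_add_lt π i
    rw [Fin.card_Ioi]
    omega
  rw [hcard, lehmer_eq_card_Ioi, (card_filter_le _ _).ge_iff_eq', eq_comm, card_filter_eq_iff]
  simp only [mem_Ioi]

theorem apply_last_eq_last_iff {π : Equiv.Perm (Fin (m + 1))} :
    π (Fin.last m) = Fin.last m ↔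
      ∀ i, 0 < Lam ⟨m + 1, π⟩ i → Lam ⟨m + 1, π⟩ i + i < m := by
  constructor
  · intro hlast i hi
    have hle := Lam_add_lt hi
    refine (Nat.lt_succ_iff.1 hle).lt_of_ne fun he => ?_
    lift i to Fin (m + 1) using lt_of_Lam_pos hi
    rw [Lam_apply] at hi he
    obtain ⟨j, hij, -⟩ := lehmer_pos_iff.1 hi
    have := lehmer_add_eq_iff.1 (congrArg (· + 1) he) _ (hij.trans_le (Fin.le_last j))
    exact this.not_ge ((Fin.le_last _).trans_eq hlast.symm)
  · intro h
    obtain ⟨i, hi⟩ := π.surjective (Fin.last m)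
    have hlehmer : lehmer π i + i + 1 = m + 1 := lehmer_add_eq_iff.2 fun j hij =>
      hi ▸ Fin.lt_last_iff_ne_last.2 fun hj => hij.ne (π.injective (hi.trans hj.symm))
    have hi0 := h i
    rw [Lam_apply] at hi0
    obtain rfl : i = Fin.last m := Fin.ext (by rw [Fin.val_last]; omega)
    exact hi

theorem indecomposable_iff_apply_last {π : Equiv.Perm (Fin (m + 1))}
    (h132 : ¬ Contains π p132.2) :
    Indecomposable ⟨m + 1, π⟩ ↔ m = 0 ∨ π (Fin.last m) ≠ Fin.last m := by
  constructor
  · rintro ⟨-, hind⟩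
    rw [or_iff_not_imp_right, not_not]
    intro hlast
    obtain ⟨α, β, rfl⟩ := exists_eq_sumPerm (a := m) (b := 1) fun i hi =>
      Fin.val_lt_last fun e => hi.ne (congrArg Fin.val (π.injective (e.trans hlast.symm)))
    simpa using hind ⟨m, α⟩ ⟨1, β⟩ rfl
  · refine fun hlast => ⟨m.succ_ne_zero, ?_⟩
    rintro ⟨a, α⟩ ⟨b, β⟩ e
    by_contra! hab
    obtain ⟨a, rfl⟩ := Nat.exists_eq_succ_of_ne_zero hab.1
    obtain ⟨b, rfl⟩ := Nat.exists_eq_succ_of_ne_zero hab.2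
    obtain rfl : m = a + 1 + b := Nat.succ_injective (congrArg Sigma.fst e)
    obtain rfl : π = sumPerm α β := eq_of_heq (Sigma.mk.inj e).2
    have hβ := apply_last_of_not_contains_sumPerm h132
    refine hlast.resolve_left (by omega) ?_
    rw [← Fin.natAdd_last]
    exact (sumPerm_natAdd α β _).trans (congrArg _ hβ)

/-- The positive lengths of permutations with inversion table `l`. -/
def tableLengths (l : ℕ →₀ ℕ) : Set ℕ := {n | 0 < n ∧ ∀ i, 0 < l i → l i + i < n}

theorem indecomposable_iff_isLeast (h132 : ¬ Contains π p132.2) :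
    Indecomposable ⟨n, π⟩ ↔ IsLeast (tableLengths (Lam ⟨n, π⟩)) n := by
  rcases n with - | m
  · exact iff_of_false (fun h => h.1 rfl) fun h => h.1.1.false
  · rw [indecomposable_iff_apply_last h132, Ne, apply_last_eq_last_iff]
    constructor
    · refine fun h => ⟨⟨m.succ_pos, fun i => Lam_add_lt⟩, fun k hk => ?_⟩
      rcases h with rfl | h
      · exact hk.1
      · push Not at h
        obtain ⟨i, hi, him⟩ := h
        exact him.trans_lt (hk.2 i hi)
    · rw [or_iff_not_imp_left]
      exact fun h hm hlt => (h.2 ⟨Nat.pos_of_ne_zero hm, hlt⟩).not_gt m.lt_succ_self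

theorem add_le_degree_of_antitone {l : ℕ →₀ ℕ} (h : Antitone l) {i : ℕ} (hi : 0 < l i) :
    l i + i ≤ l.degree := by
  have hpos : ∀ j ∈ range (i + 1), 0 < l j := fun j hj =>
    hi.trans_le (h (Nat.lt_succ_iff.1 (mem_range.1 hj)))
  calc l i + i = ∑ _j ∈ range i, 1 + l i := by simp [add_comm]
    _ ≤ ∑ j ∈ range i, l j + l i := by
      gcongr with j hj
      exact hpos j (mem_range.2 (by grind))
    _ = ∑ j ∈ range (i + 1), l j := (sum_range_succ _ _).symm
    _ ≤ l.degree := sum_le_sum_of_subset fun j hj => Finsupp.mem_support_iff.2 (hpos j hj).ne'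

theorem bijOn_Lam (k : ℕ) : Set.BijOn Lam (indecomposableAvoiders {p132, p2341} k) (SPM k) := by
  have isLeast {π : AnyPerm} (hind : Indecomposable π) (h : Avoids π.2 {p132, p2341}) :
      IsLeast (tableLengths (Lam π)) π.1 :=
    (indecomposable_iff_isLeast (avoids_pair_iff.1 h).1).1 hind
  refine ⟨?_, ?_, fun l hl => ?_⟩
  · rintro ⟨n, π⟩ ⟨-, h, rfl⟩
    exact mem_SPM_iff.2 ⟨avoids_iff_isSandPile.1 h, degree_Lam π⟩
  · rintro ⟨n, π⟩ ⟨hind, h, -⟩ ⟨n', π'⟩ ⟨hind', h', -⟩ e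
    obtain rfl : n = n' := (isLeast hind h).unique (e ▸ isLeast hind' h')
    rw [Lam_mk_injective e]
  · obtain ⟨hpile, rfl⟩ := mem_SPM_iff.1 hl
    obtain ⟨n, hn⟩ : ∃ n, IsLeast (tableLengths l) n := ⟨_, isLeast_csInf ⟨l.degree + 1,
      Nat.succ_pos _, fun i hi => Nat.lt_succ_iff.2 (add_le_degree_of_antitone hpile.1 hi)⟩⟩
    obtain ⟨π, hπ⟩ := exists_Lam_eq hn.1.2
    rw [← hπ] at hpile hn
    have h := avoids_iff_isSandPile.2 hpile
    refine ⟨_, ⟨(indecomposable_iff_isLeast (avoids_pair_iff.1 h).1).2 hn, h, ?_⟩, hπ⟩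
    rw [← degree_Lam, hπ]

theorem av_p132_p2341 {k : ℕ} (h : k < n) : av {p132, p2341} n k = (SPM k).ncard := by
  rw [av, ← Set.ncard_image_of_injective _ Lam_mk_injective]
  congr 1
  ext l
  rw [mem_SPM_iff]
  constructor
  · rintro ⟨π, ⟨hπ, hk⟩, rfl⟩
    exact ⟨avoids_iff_isSandPile.1 hπ, (degree_Lam π).trans hk⟩
  · rintro ⟨hl, rfl⟩
    obtain ⟨π, rfl⟩ := exists_Lam_eq fun i hi => (add_le_degree_of_antitone hl.1 hi).trans_lt h
    exact ⟨π, ⟨avoids_iff_isSandPile.2 hl, (degree_Lam π).symm⟩, rfl⟩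

/-! ### Generating functions -/

section GenFun

open PowerSeries (X)

variable {σ : Type*}

/-- The members of `S` of degree `k`. -/
def degreePart (S : Set (σ →₀ ℕ)) (k : ℕ) : Set (σ →₀ ℕ) := {l ∈ S | l.degree = k}

/-- The generating function counting the members of `S` by degree. A degree with infinitely many
members is given the coefficient `0`. -/
noncomputable def genFun (S : Set (σ →₀ ℕ)) : PowerSeries ℚ :=
  .mk fun k => ((degreePart S k).ncard : ℚ)

@[simp]
theorem coeff_genFun (S : Set (σ →₀ ℕ)) (k : ℕ) :
    (genFun S).coeff k = (degreePart S k).ncard :=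
  PowerSeries.coeff_mk _ _

theorem genFun_union {S T : Set (σ →₀ ℕ)} (hS : ∀ k, (degreePart S k).Finite)
    (hT : ∀ k, (degreePart T k).Finite) (h : Disjoint S T) :
    genFun (S ∪ T) = genFun S + genFun T := by
  ext k
  have hunion : degreePart (S ∪ T) k = degreePart S k ∪ degreePart T k :=
    Set.union_inter_distrib_right ..
  rw [map_add, coeff_genFun, coeff_genFun, coeff_genFun, hunion, ← Nat.cast_add,
    Set.ncard_union_eq (h.mono (fun _ hl => hl.1) fun _ hl => hl.1) (hS k) (hT k)]

theorem genFun_image_add (S : Set (σ →₀ ℕ)) (v : σ →₀ ℕ) :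
    genFun ((· + v) '' S) = X ^ v.degree * genFun S := by
  ext k
  rw [PowerSeries.coeff_X_pow_mul', coeff_genFun, coeff_genFun]
  have himage : degreePart ((· + v) '' S) k = (· + v) '' {l ∈ S | l.degree + v.degree = k} := by
    ext l
    simp only [degreePart, Set.mem_image, Set.mem_ofPred_eq]
    grind
  rw [himage, Set.ncard_image_of_injective _ (add_left_injective v)]
  split_ifs with hk
  · simp only [degreePart, eq_tsub_iff_add_eq_of_le hk]
  · have hempty : {l ∈ S | l.degree + v.degree = k} = ∅ :=
      Set.eq_empty_of_forall_notMem fun l hl => hk (hl.2 ▸ Nat.le_add_left _ _)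
    rw [hempty, Set.ncard_empty, Nat.cast_zero]

theorem genFun_singleton_zero : genFun ({0} : Set (σ →₀ ℕ)) = 1 := by
  ext k
  have hpart : degreePart {(0 : σ →₀ ℕ)} k = {l | l = 0 ∧ k = 0} := by
    ext l
    simp only [degreePart, Set.mem_singleton_iff, Set.mem_ofPred_eq]
    grind
  rw [coeff_genFun, PowerSeries.coeff_one, hpart]
  split_ifs with hk <;> simp [hk]

theorem finite_degreePart_of_antitone {S : Set (ℕ →₀ ℕ)} (hS : ∀ l ∈ S, Antitone l) (k : ℕ) :
    (degreePart S k).Finite := by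
  refine (finite_toSet (finsuppAntidiag (range k) k)).subset ?_
  rintro l ⟨hl, rfl⟩
  have hsupport : l.support ⊆ range l.degree := fun i hi => by
    have hi := Nat.pos_of_ne_zero (Finsupp.mem_support_iff.1 hi)
    have := add_le_degree_of_antitone (hS l hl) hi
    rw [mem_range]
    omega
  exact mem_finsuppAntidiag'.2 ⟨rfl, hsupport⟩

end GenFun

section Rank

open PowerSeries (X)

variable {k : ℕ} {l : ℕ →₀ ℕ}

/-- The partition `1 + ⋯ + 1` of `m`, a full column of height `m`. -/
noncomputable def column (m : ℕ) : ℕ →₀ ℕ := ∑ i ∈ range m, .single i 1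

theorem column_apply (m i : ℕ) : column m i = if i < m then 1 else 0 := by
  simp [column, Finsupp.single_apply]

theorem degree_column (m : ℕ) : (column m).degree = m := by
  simp [column]

theorem exists_eq_add_column {m : ℕ} (h : ∀ i < m, 0 < l i) : ∃ μ, l = μ + column m := by
  refine ⟨l - column m, (tsub_add_cancel_of_le fun i => ?_).symm⟩
  rw [column_apply]
  split_ifs with hi
  exacts [h i hi, Nat.zero_le _]

/-- The sand piles for which `k` is the largest number such that the staircase partition
`(k, k - 1, …, 1)` fits into them. -/
def pilesOfRank (k : ℕ) : Set (ℕ →₀ ℕ) :=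
  {l | IsSandPile l ∧ IsLeast (Set.range fun p => l p + p) k}

theorem mem_pilesOfRank_iff :
    l ∈ pilesOfRank k ↔ IsSandPile l ∧ (∀ p, k ≤ l p + p) ∧ ∃ p, l p + p = k := by
  simp [pilesOfRank, IsLeast, lowerBounds, and_comm]

theorem pilesOfRank_zero : pilesOfRank 0 = {0} := by
  ext l
  rw [mem_pilesOfRank_iff, Set.mem_singleton_iff]
  constructor
  · rintro ⟨hl, -, p, hp⟩
    ext i
    have := hl.1 (Nat.zero_le i)
    obtain rfl : p = 0 := by omega
    rw [Finsupp.zero_apply]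
    omega
  · rintro rfl
    exact ⟨⟨antitone_const, by simp⟩, by simp, 0, by simp⟩

theorem finite_degreePart_of_subset_pilesOfRank {S : Set (ℕ →₀ ℕ)} (h : S ⊆ pilesOfRank k)
    (d : ℕ) : (degreePart S d).Finite :=
  finite_degreePart_of_antitone (fun _ hl => (h hl).1.1) d

theorem apply_le_one_of_mem_pilesOfRank (h : l ∈ pilesOfRank k) : l k ≤ 1 := by
  obtain ⟨hl, -, p, hp⟩ := mem_pilesOfRank_iff.1 h
  by_contra hk
  rcases (show p ≤ k by omega).lt_or_eq with hpk | rfl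
  · have := hl.2 p k hpk (by omega)
    omega
  · omega

theorem apply_eq_zero_of_mem_pilesOfRank {i : ℕ} (h : l ∈ pilesOfRank k) (hi : k < i) :
    l i = 0 := by
  obtain ⟨hl, -, p, hp⟩ := mem_pilesOfRank_iff.1 h
  by_contra hne
  have := hl.2 p i (by omega) (by omega)
  omega

theorem apply_pos_of_mem_pilesOfRank {i : ℕ} (h : l ∈ pilesOfRank k) (hi : i < k) : 0 < l i := by
  have := (mem_pilesOfRank_iff.1 h).2.1 i
  omega

theorem isSandPile_add_column_iff {m : ℕ} (hzero : ∀ i, m ≤ i → l i = 0)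
    (hmin : ∀ p < m, m ≤ l p + p + 2) : IsSandPile (l + column m) ↔ IsSandPile l := by
  have happly (i : ℕ) : (l + column m) i = if i < m then l i + 1 else 0 := by
    rw [Finsupp.add_apply, column_apply]
    have := hzero i
    split_ifs <;> omega
  constructor <;> refine fun h => ⟨fun i j hij => ?_, fun p r hpr hr => ?_⟩
  · have := h.1 hij
    have := hzero j
    grind
  · have := h.2 p r hpr
    have := hzero r
    grind
  · have := h.1 hij
    grind
  · have := h.2 p r hpr
    have := hmin p
    grind

theorem add_column_mem_pilesOfRank_apply_one_iff :
    l + column (k + 2) ∈ pilesOfRank (k + 1) ∧ (l + column (k + 2)) (k + 1) = 1 ↔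
      l ∈ pilesOfRank k := by
  have happly (i : ℕ) : (l + column (k + 2)) i = if i < k + 2 then l i + 1 else l i := by
    rw [Finsupp.add_apply, column_apply]
    split_ifs <;> rfl
  constructor
  · rintro ⟨h, h1⟩
    have hzero (i) (hi : k + 2 ≤ i) : l i = 0 := by
      have := apply_eq_zero_of_mem_pilesOfRank h (i := i) (by omega)
      grind
    rw [mem_pilesOfRank_iff] at h ⊢
    obtain ⟨hl, hle, p, hp⟩ := h
    refine ⟨(isSandPile_add_column_iff hzero fun p _ => ?_).1 hl, fun p => ?_, p, ?_⟩
    · have := hle p; grind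
    · have := hle p; grind
    · grind
  · intro h
    have hzero (i) (hi : k < i) : l i = 0 := apply_eq_zero_of_mem_pilesOfRank h hi
    rw [mem_pilesOfRank_iff] at h ⊢
    obtain ⟨hl, hle, p, hp⟩ := h
    refine ⟨⟨(isSandPile_add_column_iff (fun i hi => hzero i (by omega)) fun p _ => ?_).2 hl,
      fun p => ?_, p, ?_⟩, ?_⟩
    · have := hle p; grind
    · have := hle p; grind
    · grind
    · grind

theorem add_column_mem_pilesOfRank_apply_zero_iff :
    l + column (k + 1) ∈ pilesOfRank (k + 1) ∧ (l + column (k + 1)) (k + 1) = 0 ↔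
      (l ∈ pilesOfRank (k + 1) ∧ l (k + 1) = 0) ∨ l ∈ pilesOfRank k := by
  have happly (i : ℕ) : (l + column (k + 1)) i = if i < k + 1 then l i + 1 else l i := by
    rw [Finsupp.add_apply, column_apply]
    split_ifs <;> rfl
  constructor
  · rintro ⟨h, h0⟩
    rw [mem_pilesOfRank_iff] at h
    obtain ⟨hl, hle, -⟩ := h
    have hzero (i) (hi : k + 1 ≤ i) : l i = 0 := by
      have := hl.1 hi
      grind
    have hmin (p) : k ≤ l p + p := by
      have := hle p
      grind
    have hpile := (isSandPile_add_column_iff hzero fun p _ => by have := hmin p; omega).1 hl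
    by_cases hk : ∃ p, l p + p = k
    · exact .inr (mem_pilesOfRank_iff.2 ⟨hpile, hmin, hk⟩)
    · push Not at hk
      refine .inl ⟨mem_pilesOfRank_iff.2 ⟨hpile, fun p => ?_, k + 1, ?_⟩, hzero _ le_rfl⟩
      · exact (hmin p).lt_of_ne' (hk p)
      · rw [hzero _ le_rfl, zero_add]
  · intro h
    have hzero (i) (hi : k + 1 ≤ i) : l i = 0 := by
      rcases h with ⟨h, h0⟩ | h
      · exact Nat.eq_zero_of_le_zero (h0 ▸ h.1.1 hi)
      · exact apply_eq_zero_of_mem_pilesOfRank h hi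
    have hmin (p) : k ≤ l p + p := by
      rcases h with ⟨h, -⟩ | h
      · exact (Nat.le_succ k).trans ((mem_pilesOfRank_iff.1 h).2.1 p)
      · exact (mem_pilesOfRank_iff.1 h).2.1 p
    have hpile : IsSandPile l := h.elim (·.1.1) (·.1)
    rw [mem_pilesOfRank_iff]
    refine ⟨⟨(isSandPile_add_column_iff hzero fun p _ => by have := hmin p; omega).2 hpile,
      fun p => ?_, k + 1, ?_⟩, ?_⟩
    · have := hmin p; grind
    · grind
    · grind

theorem setOf_mem_pilesOfRank_apply_one : {l ∈ pilesOfRank (k + 1) | l (k + 1) = 1} =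
    (· + column (k + 2)) '' pilesOfRank k := by
  ext l
  constructor
  · rintro ⟨hl, h1⟩
    obtain ⟨μ, rfl⟩ := exists_eq_add_column (l := l) (m := k + 2) fun i hi =>
      h1.symm.trans_le (hl.1.1 (Nat.lt_succ_iff.1 hi))
    exact ⟨μ, add_column_mem_pilesOfRank_apply_one_iff.1 ⟨hl, h1⟩, rfl⟩
  · rintro ⟨μ, hμ, rfl⟩
    exact add_column_mem_pilesOfRank_apply_one_iff.2 hμ

theorem setOf_mem_pilesOfRank_apply_zero : {l ∈ pilesOfRank (k + 1) | l (k + 1) = 0} =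
    (· + column (k + 1)) '' ({l ∈ pilesOfRank (k + 1) | l (k + 1) = 0} ∪ pilesOfRank k) := by
  ext l
  constructor
  · rintro ⟨hl, h0⟩
    obtain ⟨μ, rfl⟩ := exists_eq_add_column (l := l) (m := k + 1) fun i hi =>
      apply_pos_of_mem_pilesOfRank hl hi
    exact ⟨μ, add_column_mem_pilesOfRank_apply_zero_iff.1 ⟨hl, h0⟩, rfl⟩
  · rintro ⟨μ, hμ, rfl⟩
    exact add_column_mem_pilesOfRank_apply_zero_iff.2 hμ

theorem pairwise_disjoint_pilesOfRank : Pairwise (Function.onFun Disjoint pilesOfRank) :=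
  fun _ _ hne => Set.disjoint_left.2 fun _ h h' => hne (h.2.unique h'.2)

theorem genFun_pilesOfRank_succ (k : ℕ) : genFun (pilesOfRank (k + 1)) =
    X ^ (k + 1) * (X + (1 - X ^ (k + 1))⁻¹) * genFun (pilesOfRank k) := by
  set S₀ := {l ∈ pilesOfRank (k + 1) | l (k + 1) = 0} with hS₀
  set S₁ := {l ∈ pilesOfRank (k + 1) | l (k + 1) = 1} with hS₁
  have finite₀ := finite_degreePart_of_subset_pilesOfRank (Set.sep_subset _ _ : S₀ ⊆ _)
  have finite₁ := finite_degreePart_of_subset_pilesOfRank (Set.sep_subset _ _ : S₁ ⊆ _)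
  have hsplit : genFun (pilesOfRank (k + 1)) = genFun S₀ + genFun S₁ := by
    rw [← genFun_union finite₀ finite₁ (Set.disjoint_left.2 fun l h h' => by grind)]
    congr 1
    ext l
    have := apply_le_one_of_mem_pilesOfRank (k := k + 1) (l := l)
    grind
  have hgen₀ : genFun S₀ = X ^ (k + 1) * (genFun S₀ + genFun (pilesOfRank k)) := by
    rw [← genFun_union finite₀ (finite_degreePart_of_subset_pilesOfRank subset_rfl)
      ((pairwise_disjoint_pilesOfRank k.succ_ne_self).mono_left (Set.sep_subset _ _))]
    conv_lhs => rw [hS₀, setOf_mem_pilesOfRank_apply_zero, genFun_image_add, degree_column]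
  have hgen₁ : genFun S₁ = X ^ (k + 2) * genFun (pilesOfRank k) := by
    rw [hS₁, setOf_mem_pilesOfRank_apply_one, genFun_image_add, degree_column]
  have hinv : (1 - X ^ (k + 1) : PowerSeries ℚ)⁻¹ * (1 - X ^ (k + 1)) = 1 :=
    PowerSeries.inv_mul_cancel _ (by simp)
  rw [hsplit, hgen₁]
  linear_combination (1 - X ^ (k + 1) : PowerSeries ℚ)⁻¹ * hgen₀ - genFun S₀ * hinv

theorem genFun_pilesOfRank (k : ℕ) : genFun (pilesOfRank k) = spmTerm k := by
  induction k with
  | zero => simp [pilesOfRank_zero, genFun_singleton_zero, spmTerm]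
  | succ k ih =>
    have htriangle : (k + 1) * (k + 1 + 1) / 2 = k * (k + 1) / 2 + (k + 1) := by
      rw [show (k + 1) * (k + 1 + 1) = k * (k + 1) + (k + 1) * 2 by ring,
        Nat.add_mul_div_right _ _ two_pos]
    rw [genFun_pilesOfRank_succ, ih, spmTerm, spmTerm, prod_Icc_succ_top (by omega), htriangle,
      pow_add]
    ring

theorem le_degree_of_mem_pilesOfRank (h : l ∈ pilesOfRank k) : k ≤ l.degree :=
  ((mem_pilesOfRank_iff.1 h).2.1 0).trans (Finsupp.le_degree 0 l)

theorem SPM_eq_biUnion (d : ℕ) :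
    SPM d = ⋃ k ∈ range (d + 1), degreePart (pilesOfRank k) d := by
  ext l
  simp only [Set.mem_iUnion, exists_prop, mem_SPM_iff]
  constructor
  · rintro ⟨hl, rfl⟩
    have hrank : l ∈ pilesOfRank _ := ⟨hl, isLeast_csInf (Set.range_nonempty _)⟩
    exact ⟨_, mem_range_succ_iff.2 (le_degree_of_mem_pilesOfRank hrank), hrank, rfl⟩
  · rintro ⟨k, -, hl, rfl⟩
    exact ⟨hl.1, rfl⟩

theorem ncard_SPM (d : ℕ) :
    (SPM d).ncard = ∑ k ∈ range (d + 1), (degreePart (pilesOfRank k) d).ncard := by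
  rw [SPM_eq_biUnion, ← finsum_mem_coe_finset]
  refine (finite_toSet (range (d + 1))).ncard_biUnion
    (fun k _ => finite_degreePart_of_subset_pilesOfRank subset_rfl d) fun k _ k' _ hne => ?_
  exact (pairwise_disjoint_pilesOfRank hne).mono (fun _ h => h.1) fun _ h => h.1

theorem hasSum_spmTerm : HasSum spmTerm (.mk fun d => ((SPM d).ncard : ℚ)) := by
  rw [PowerSeries.WithPiTopology.hasSum_iff_hasSum_coeff]
  intro d
  simp only [PowerSeries.coeff_mk, ncard_SPM, Nat.cast_sum, ← genFun_pilesOfRank, coeff_genFun]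
  refine hasSum_sum_of_ne_finset_zero fun k hk => ?_
  have hempty : degreePart (pilesOfRank k) d = ∅ := Set.eq_empty_of_forall_notMem fun l hl =>
    hk (mem_range_succ_iff.2 (hl.2 ▸ le_degree_of_mem_pilesOfRank hl.1))
  rw [hempty, Set.ncard_empty, Nat.cast_zero]

theorem summable_spmTerm_succ : Summable fun k : ℕ => spmTerm (k + 1) :=
  (summable_nat_add_iff 1).2 hasSum_spmTerm.summable

theorem spmSeries_eq : spmSeries = .mk fun d => ((SPM d).ncard : ℚ) := by
  rw [← hasSum_spmTerm.tsum_eq, hasSum_spmTerm.summable.tsum_eq_zero_add, spmSeries]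
  simp [spmTerm]

end Rank

/-! ### Inversion of the reverse complement -/

/-- The inverse of the reverse complement of `π`: the symmetry, preserving inversions and pattern
containment, which exchanges `132` with `213` and fixes `2341`. -/
def invRevCompl (π : Equiv.Perm (Fin n)) : Equiv.Perm (Fin n) :=
  (Fin.revPerm.trans π.symm).trans Fin.revPerm

theorem invRevCompl_apply (π : Equiv.Perm (Fin n)) (i : Fin n) :
    invRevCompl π i = (π.symm i.rev).rev := rfl

@[simp]
theorem invRevCompl_rev_apply (π : Equiv.Perm (Fin n)) (i : Fin n) :
    invRevCompl π (π i).rev = i.rev := by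
  simp [invRevCompl_apply]

theorem invRevCompl_involutive :
    Function.Involutive (invRevCompl : Equiv.Perm (Fin n) → Equiv.Perm (Fin n)) := by
  intro π
  ext1 i
  rw [invRevCompl_apply, Fin.rev_eq_iff, Equiv.symm_apply_eq, invRevCompl_rev_apply]

theorem inv_invRevCompl (π : Equiv.Perm (Fin n)) : inv (invRevCompl π) = inv π := by
  symm
  refine card_nbij' (fun q => ((π q.1).rev, (π q.2).rev))
    (fun q => (π.symm q.1.rev, π.symm q.2.rev)) ?_ ?_ ?_ ?_ <;>
  simp +contextual [Set.MapsTo, Set.LeftInvOn, invRevCompl_apply]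

theorem Contains.invRevCompl {p : Equiv.Perm (Fin m)} (h : Contains π p) :
    Contains (invRevCompl π) (invRevCompl p) := by
  rw [contains_iff_exists_strictMono] at h ⊢
  obtain ⟨f, hf, hπ⟩ := h
  refine ⟨fun i => (π (f (p.symm i.rev))).rev, fun i j hij => ?_, fun i j hij => ?_⟩
  · exact Fin.rev_lt_rev.2 (hπ (Fin.rev_lt_rev.2 hij))
  · simpa [PermPattern.invRevCompl] using hf (Fin.rev_lt_rev.2 hij)

theorem contains_invRevCompl_iff {p : Equiv.Perm (Fin m)} :
    Contains (invRevCompl π) p ↔ Contains π (invRevCompl p) := by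
  constructor <;> intro h <;> simpa only [invRevCompl_involutive _] using h.invRevCompl

theorem avoids_invRevCompl_iff {B : Set AnyPerm} :
    Avoids (invRevCompl π) B ↔ Avoids π (Sigma.map id (fun _ => invRevCompl) '' B) := by
  simp only [Avoids, Set.forall_mem_image, contains_invRevCompl_iff]
  rfl

theorem av_image_invRevCompl (B : Set AnyPerm) (n k : ℕ) :
    av (Sigma.map id (fun _ => invRevCompl) '' B) n k = av B n k := by
  rw [av, ← Set.ncard_image_of_injective _ invRevCompl_involutive.injective,
    Set.image_eq_preimage_of_inverse invRevCompl_involutive invRevCompl_involutive]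
  simp only [Set.preimage_ofPred_eq, ← avoids_invRevCompl_iff, invRevCompl_involutive _,
    inv_invRevCompl]
  rfl

theorem av_p213_p2341 (n k : ℕ) : av {p213, p2341} n k = av {p132, p2341} n k := by
  have h213 : Sigma.map id (fun _ => invRevCompl) p132 = p213 := by
    refine congrArg (Sigma.mk 3) (Equiv.ext fun i => ?_)
    fin_cases i <;> rfl
  have h2341 : Sigma.map id (fun _ => invRevCompl) p2341 = p2341 := by
    refine congrArg (Sigma.mk 4) (Equiv.ext fun i => ?_)
    fin_cases i <;> rfl
  rw [← av_image_invRevCompl {p132, p2341}, Set.image_pair, h213, h2341]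

/-! ### Decomposition of `1324`-avoiders -/

section SumPerm

variable {a b : ℕ}

theorem sumPerm_injective : Function.Injective
    fun q : Equiv.Perm (Fin a) × Equiv.Perm (Fin b) => sumPerm q.1 q.2 := by
  rintro ⟨α, β⟩ ⟨α', β'⟩ h
  refine Prod.ext (Equiv.ext fun i => ?_) (Equiv.ext fun i => ?_)
  · simpa using DFunLike.congr_fun h (Fin.castAdd b i)
  · simpa using DFunLike.congr_fun h (Fin.natAdd a i)

theorem inv_sumPerm (α : Equiv.Perm (Fin a)) (β : Equiv.Perm (Fin b)) :
    inv (sumPerm α β) = inv α + inv β := by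
  simp [inv_eq_sum_lehmer, lehmer, card_filter, Fin.sum_univ_add, -sum_boole]

theorem contains_p2341_sumPerm_iff {α : Equiv.Perm (Fin a)} {β : Equiv.Perm (Fin b)} :
    Contains (sumPerm α β) p2341.2 ↔ Contains α p2341.2 ∨ Contains β p2341.2 := by
  simp only [contains_p2341_iff]
  constructor
  · rintro ⟨w, x, y, z, hwx, hxy, hyz, hzw, hwx', hxy'⟩
    induction w using Fin.addCases <;> induction x using Fin.addCases <;>
      induction y using Fin.addCases <;> induction z using Fin.addCases <;>
      simp_all <;> grind
  · rintro (⟨w, x, y, z, h⟩ | ⟨w, x, y, z, h⟩)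
    · exact ⟨Fin.castAdd b w, Fin.castAdd b x, Fin.castAdd b y, Fin.castAdd b z, by simpa using h⟩
    · exact ⟨Fin.natAdd a w, Fin.natAdd a x, Fin.natAdd a y, Fin.natAdd a z, by simpa using h⟩

theorem contains_p1324_sumPerm_iff (ha : 0 < a) (hb : 0 < b) {α : Equiv.Perm (Fin a)}
    {β : Equiv.Perm (Fin b)} :
    Contains (sumPerm α β) p1324.2 ↔ Contains α p132.2 ∨ Contains β p213.2 := by
  have i : Fin a := ⟨0, ha⟩
  have j : Fin b := ⟨0, hb⟩
  simp only [contains_p1324_iff, contains_p132_iff, contains_p213_iff]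
  constructor
  · rintro ⟨w, x, y, z, hwx, hxy, hyz, hwy, hyx, hxz⟩
    induction w using Fin.addCases <;> induction x using Fin.addCases <;>
      induction y using Fin.addCases <;> induction z using Fin.addCases <;>
      simp_all <;> grind
  · rintro (⟨x, y, z, h⟩ | ⟨x, y, z, h⟩)
    · exact ⟨Fin.castAdd b x, Fin.castAdd b y, Fin.castAdd b z, Fin.natAdd a j, by simpa using h⟩
    · exact ⟨Fin.castAdd b i, Fin.natAdd a x, Fin.natAdd a y, Fin.natAdd a z, by simpa using h⟩

theorem avoids_sumPerm_iff (ha : 0 < a) (hb : 0 < b) {α : Equiv.Perm (Fin a)}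
    {β : Equiv.Perm (Fin b)} :
    Avoids (sumPerm α β) {p1324, p2341} ↔ Avoids α {p132, p2341} ∧ Avoids β {p213, p2341} := by
  simp only [avoids_pair_iff, contains_p1324_sumPerm_iff ha hb, contains_p2341_sumPerm_iff]
  tauto

end SumPerm

theorem le_inv_of_forall_lt {i j : Fin n} (hij : i < j) (hji : π j < π i)
    (hmin : ∀ x < i, π j < π x) : (j : ℕ) ≤ inv π := by
  -- A position `p < j` is inverted with `j` or, when `π p < π j`, lies after `i` and is inverted
  -- with `i`.
  let f (p : Fin n) : Fin n × Fin n := if π j < π p then (p, j) else (i, p)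
  rw [← Fin.card_Iio, inv]
  refine card_le_card_of_injOn f (fun p hp => ?_) fun p hp q hq => ?_
  · have hpj : p < j := by simpa using hp
    have hip : ¬ π j < π p → i < p ∧ π p < π i := fun h => by
      have hle : π p ≤ π j := not_lt.1 h
      refine ⟨lt_of_not_ge fun hpi => ?_, hle.trans_lt hji⟩
      rcases hpi.lt_or_eq with hpi | rfl
      · exact h (hmin p hpi)
      · exact h hji
    by_cases h : π j < π p
    · simp [f, h, hpj]
    · simp [f, h, hip h]
  · have hpj : p < j := by simpa using hp
    have hqj : q < j := by simpa using hq
    simp only [f]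
    grind

theorem le_inv_add_of_forall_gt {i j : Fin n} (hij : i < j) (hji : π j < π i)
    (hmax : ∀ y, j < y → π y < π i) : n ≤ inv π + π j + 1 := by
  have h := le_inv_of_forall_lt (π := invRevCompl π) (i := (π i).rev) (j := (π j).rev)
    (Fin.rev_lt_rev.2 hji) (by simpa using hij) fun x hx => by
      obtain ⟨y, rfl⟩ : ∃ y, (π y).rev = x := ⟨π.symm x.rev, by simp⟩
      rw [Fin.rev_lt_rev] at hx
      rw [invRevCompl_rev_apply, invRevCompl_rev_apply, Fin.rev_lt_rev]
      by_contra hyj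
      rcases (not_lt.1 hyj).lt_or_eq with hyj | rfl
      · exact hx.not_gt (hmax y hyj)
      · exact hx.not_gt hji
  rw [inv_invRevCompl, Fin.val_rev] at h
  omega

theorem exists_le_apply_lt {i : Fin n} (hi : (i : ℕ) < m) (hπi : m ≤ π i) :
    ∃ j : Fin n, m ≤ j ∧ (π j : ℕ) < m := by
  by_contra! h
  have hmaps : Set.MapsTo π {x : Fin n | m ≤ x} {x : Fin n | m ≤ x} := h
  exact hi.not_ge (by simpa using Equiv.Perm.perm_symm_mapsTo_of_mapsTo π hmaps hπi)

theorem apply_lt_of_not_contains_p1324 (h : ¬ Contains π p1324.2) (hm : inv π < m)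
    (hn : inv π + m < n) {i : Fin n} (hi : (i : ℕ) < m) : (π i : ℕ) < m := by
  by_contra! hmi
  obtain ⟨j, hmj, hj⟩ := exists_le_apply_lt hi hmi
  have hij : i < j := Fin.lt_def.2 (hi.trans_le hmj)
  have hji : π j < π i := Fin.lt_def.2 (hj.trans_le hmi)
  obtain ⟨x, hxi, hxj⟩ : ∃ x < i, π x < π j := by
    by_contra! hmin
    have := le_inv_of_forall_lt hij hji fun x hx =>
      (hmin x hx).lt_of_ne (π.injective.ne (hx.trans hij).ne')
    omega
  obtain ⟨y, hjy, hiy⟩ : ∃ y, j < y ∧ π i < π y := by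
    by_contra! hmax
    have := le_inv_add_of_forall_gt hij hji fun y hy =>
      (hmax y hy).lt_of_ne (π.injective.ne (hij.trans hy).ne')
    omega
  exact h (contains_p1324_iff.2 ⟨x, i, j, y, hxi, hij, hjy, hxj, hji, hiy⟩)

theorem ncard_setOf_add_eq {α β : Type*} [Finite α] [Finite β] (P : α → Prop) (Q : β → Prop)
    (f : α → ℕ) (g : β → ℕ) (k : ℕ) :
    {q : α × β | (P q.1 ∧ Q q.2) ∧ f q.1 + g q.2 = k}.ncard =
      ∑ q ∈ antidiagonal k, {a | P a ∧ f a = q.1}.ncard * {b | Q b ∧ g b = q.2}.ncard := by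
  have hunion : {q : α × β | (P q.1 ∧ Q q.2) ∧ f q.1 + g q.2 = k} =
      ⋃ q ∈ (antidiagonal k : Set (ℕ × ℕ)), {a | P a ∧ f a = q.1} ×ˢ {b | Q b ∧ g b = q.2} := by
    ext ⟨a, b⟩
    simp only [Set.mem_ofPred_eq, Set.mem_iUnion, Set.mem_prod, SetLike.mem_coe,
      HasAntidiagonal.mem_antidiagonal, Prod.exists, exists_prop]
    grind
  rw [hunion, (finite_toSet _).ncard_biUnion (fun _ _ => Set.toFinite _),
    finsum_mem_coe_finset]
  · simp only [Set.ncard_prod]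
  · intro q _ r _ hqr
    refine Set.disjoint_left.2 fun x hq hr => hqr (Prod.ext ?_ ?_)
    · exact hq.1.2.symm.trans hr.1.2
    · exact hq.2.2.symm.trans hr.2.2

theorem av_add_p1324_p2341 {a b k : ℕ} (ha : k < a) (hb : k < b) :
    av {p1324, p2341} (a + b) k =
      ∑ q ∈ antidiagonal k, av {p132, p2341} a q.1 * av {p213, p2341} b q.2 := by
  have havoids := @avoids_sumPerm_iff a b (by omega) (by omega)
  have hsplit : {π : Equiv.Perm (Fin (a + b)) | Avoids π {p1324, p2341} ∧ inv π = k} =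
      (fun q => sumPerm q.1 q.2) '' {q : Equiv.Perm (Fin a) × Equiv.Perm (Fin b) |
        (Avoids q.1 {p132, p2341} ∧ Avoids q.2 {p213, p2341}) ∧ inv q.1 + inv q.2 = k} := by
    ext π
    constructor
    · rintro ⟨h, hk⟩
      obtain ⟨α, β, rfl⟩ := exists_eq_sumPerm fun i hi =>
        apply_lt_of_not_contains_p1324 (avoids_pair_iff.1 h).1 (hk.trans_lt ha) (by omega) hi
      exact ⟨(α, β), ⟨havoids.1 h, (inv_sumPerm α β).symm.trans hk⟩, rfl⟩
    · rintro ⟨⟨α, β⟩, ⟨h, hk⟩, rfl⟩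
      exact ⟨havoids.2 h, (inv_sumPerm α β).trans hk⟩
  rw [av, hsplit, Set.ncard_image_of_injective _ sumPerm_injective]
  exact ncard_setOf_add_eq (Avoids · {p132, p2341}) (Avoids · {p213, p2341}) inv inv k

theorem isLimitGenFun_p132_p2341 : IsLimitGenFun {p132, p2341} spmSeries :=
  ⟨fun k => (SPM k).ncard, fun k => ⟨k + 1, fun _ hn => av_p132_p2341 hn⟩, spmSeries_eq⟩

theorem isLimitGenFun_p1324_p2341 : IsLimitGenFun {p1324, p2341} (spmSeries ^ 2) := by
  refine ⟨fun k => ∑ q ∈ antidiagonal k, (SPM q.1).ncard * (SPM q.2).ncard,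
    fun k => ⟨(k + 1) + (k + 1), fun n hn => ?_⟩, ?_⟩
  · obtain ⟨b, rfl⟩ := Nat.exists_eq_add_of_le ((Nat.le_add_right _ _).trans hn)
    rw [av_add_p1324_p2341 k.lt_succ_self (by omega)]
    refine sum_congr rfl fun q hq => ?_
    rw [HasAntidiagonal.mem_antidiagonal] at hq
    rw [av_p213_p2341, av_p132_p2341 (by omega), av_p132_p2341 (by omega)]
  · ext k
    simp [spmSeries_eq, pow_two, PowerSeries.coeff_mul]

end PermPattern

theorem proposition7p2 :
    (∀ k : ℕ, Set.BijOn PermPattern.Lam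
      (PermPattern.indecomposableAvoiders {PermPattern.p132, PermPattern.p2341} k)
      (PermPattern.SPM k)) ∧
    Summable (fun k : ℕ => PermPattern.spmTerm (k + 1)) ∧
    PermPattern.IsLimitGenFun {PermPattern.p132, PermPattern.p2341} PermPattern.spmSeries ∧
    PermPattern.IsLimitGenFun {PermPattern.p1324, PermPattern.p2341}
      (PermPattern.spmSeries ^ 2) :=
  ⟨PermPattern.bijOn_Lam, PermPattern.summable_spmTerm_succ,
    PermPattern.isLimitGenFun_p132_p2341, PermPattern.isLimitGenFun_p1324_p2341⟩
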